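/- Let $\Phi$ be a root system (finite and crystallographic, possibly unreduced, possibly not irreducible) in a real vector space $V$, and let $\Delta$ be the set of simple roots of $\Phi$ with respect to some ordering, i.e. a total ordering making $V$ an ordered real vector space, where a root is simple if it is positive and is not the sum of two positive roots. For $\alpha\in\Delta$ set $\hat\alpha=2\alpha$ if $2\alpha\in\Phi$, and $\hat\alpha=\alpha$ otherwise; let $\hat\Delta=\{\hat\alpha\mid\alpha\in\Delta\}$. Then there is a total ordering of the set $\hat\Delta$ with the following property. Let $\hat\alpha\in\hat\Delta$. Suppose that each of the elements of $\hat\Delta$ that precede $\hat\alpha$ in this ordering is labeled by one of the letters "U" or "D" (arbitrarily), and that $\hat\alpha$ itself is labeled "D". Call the elements of $\hat\Delta$ labeled "D" the D-nodes and those labeled "U" the U-nodes (elements that come after $\hat\alpha$ are not labeled). Then there exist $\sigma,\mu\in\Phi\cup\{0\}$ such that: 1. $\mu-\sigma=\hat\alpha$; 2. for every $\phi\in\Phi\cup\{0\}$, the difference $\sigma-\phi$ is not a positive real multiple of a D-node; 3. for every $\phi\in\Phi\cup\{0\}$, the difference $\phi-\sigma$ is not a positive real multiple of a U-node. -/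

import Mathlib

open Set

/-- The set `Φ` of roots of a root pairing. -/
def RootPairing.rootSet {ι M N : Type*} [AddCommGroup M] [Module ℝ M] [AddCommGroup N] [Module ℝ N]
    (P : RootPairing ι ℝ M N) : Set M :=
  range P.root

/-- The set `Φ ∪ {0}`. -/
def RootPairing.rootSetZero {ι M N : Type*} [AddCommGroup M] [Module ℝ M]
    [AddCommGroup N] [Module ℝ N] (P : RootPairing ι ℝ M N) : Set M :=
  P.rootSet ∪ {0}

/-- The set `Δ` of simple roots with respect to a total ordering of the ambient vector space:
the positive roots that are not a sum of two positive roots. (In the unreduced case the positive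
root `2α = α + α` is thus never simple.) -/
def RootPairing.simpleRoots {ι M N : Type*} [AddCommGroup M] [Module ℝ M]
    [AddCommGroup N] [Module ℝ N] [LinearOrder M] (P : RootPairing ι ℝ M N) : Set M :=
  {α | α ∈ P.rootSet ∧ 0 < α ∧
    ∀ β ∈ P.rootSet, ∀ γ ∈ P.rootSet, 0 < β → 0 < γ → α ≠ β + γ}

open Classical in
/-- `α̂ = 2α` if `2α` is a root, and `α̂ = α` otherwise. -/
noncomputable def RootPairing.hat {ι M N : Type*} [AddCommGroup M] [Module ℝ M]
    [AddCommGroup N] [Module ℝ N] (P : RootPairing ι ℝ M N) (α : M) : M :=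
  if (2 : ℝ) • α ∈ P.rootSet then (2 : ℝ) • α else α

/-- The set `Δ̂ = {α̂ | α ∈ Δ}`. -/
def RootPairing.hatSimpleRoots {ι M N : Type*} [AddCommGroup M] [Module ℝ M]
    [AddCommGroup N] [Module ℝ N] [LinearOrder M] (P : RootPairing ι ℝ M N) : Set M :=
  P.hat '' P.simpleRoots

/-- The two letters used as labels. -/
inductive NodeLabel : Type
  | U
  | D

/-- Given a label for every element preceding `a` in the ordering `r`, the node `b` is a D-node
if it is `a` itself or it precedes `a` and carries the label `D`. -/
def IsDNode {V : Type*} {r : V → V → Prop} {a : V} (label : {b : V // r b a} → NodeLabel)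
    (b : V) : Prop :=
  b = a ∨ ∃ h : r b a, label ⟨b, h⟩ = NodeLabel.D

/-- The node `b` is a U-node if it precedes `a` and carries the label `U`. -/
def IsUNode {V : Type*} {r : V → V → Prop} {a : V} (label : {b : V // r b a} → NodeLabel)
    (b : V) : Prop :=
  ∃ h : r b a, label ⟨b, h⟩ = NodeLabel.U

/-- `v` is a positive (real) multiple of `w`. -/
def IsPosMultiple {M : Type*} [AddCommGroup M] [Module ℝ M] (v w : M) : Prop :=
  ∃ c : ℝ, 0 < c ∧ v = c • w

/-!
The proof is uniform and does not use the classification of root systems. Let `(·, ·)` be the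
canonical invariant form `P.RootForm`. The set `Δ̂` is a basis of the space, in which the coordinates
of every root have a common sign (`RootPairing.exists_basis_hatSimpleRoots`).

The ordering is built from its last element downwards. Given a nonempty `J ⊆ Δ̂`, let `θ` be a
longest root in the span of `J` with `(θ, β) ≥ 0` for all `β ∈ J`, and let any `a ∈ J` with
`(θ, a) > 0` be the last element of `J`; then continue with `J \ {a}`
(`exists_isStrictTotalOrder_of_exists_last`).

With signs prescribed on `J \ {a}`, let `σ = w θ` be such that the functional given by the signs
is maximal, where `w` runs through the isometries that preserve the roots and move vectors only
along `J \ {a}` (these include the Weyl group of `J \ {a}`). Then `(σ, β)` has the prescribed weak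
sign for every `β ∈ J \ {a}`, and `(σ, a) > 0`, because `(σ, a) = (θ, γ)` for the root
`γ = w⁻¹ a`, which differs from `a` only along `J \ {a}`: such a root has nonnegative coordinates, and
coordinate `1` at `a` (`RootPairing.exists_longest_with_signs`). Hence `σ - a` is a root or zero.
As `σ` is a longest root in the span of `J`, no vector `σ + c β` with `β ∈ J`, `c ≠ 0` and
`c (σ, β) ≥ 0` is a root or zero, since it is longer than `σ`
(`RootPairing.longest_add_smul_notMem_rootSetZero`). So the pair consisting of `-σ` and `a - σ`
has the required properties.
-/

namespace RootPairing

variable {ι M N : Type*} [AddCommGroup M] [Module ℝ M] [AddCommGroup N] [Module ℝ N]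
  (P : RootPairing ι ℝ M N)

/-! ### Simple roots -/

section SimpleRoots

lemma eq_zero_of_rootForm_self_nonpos [Fintype ι] [P.IsRootSystem] {x : M}
    (h : P.RootForm x x ≤ 0) : x = 0 :=
  P.rootForm_anisotropic x (h.antisymm (P.zero_le_rootForm x))

lemma hat_mem_rootSet {α : M} (h : α ∈ P.rootSet) : P.hat α ∈ P.rootSet := by
  unfold hat
  split_ifs with h2
  exacts [h2, h]

lemma exists_pos_hat_eq_smul (α : M) : ∃ c : ℝ, 0 < c ∧ P.hat α = c • α := by
  unfold hat
  split_ifs with h2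
  exacts [⟨2, two_pos, rfl⟩, ⟨1, one_pos, (one_smul ℝ α).symm⟩]

lemma exists_pos_eq_smul_hat (α : M) : ∃ c : ℝ, 0 < c ∧ α = c • P.hat α := by
  obtain ⟨c, hc, h⟩ := P.exists_pos_hat_eq_smul α
  exact ⟨c⁻¹, inv_pos.2 hc, by rw [h, inv_smul_smul₀ hc.ne']⟩

variable [LinearOrder M]

lemma mem_rootSet_of_mem_hatSimpleRoots {x : M} (h : x ∈ P.hatSimpleRoots) : x ∈ P.rootSet := by
  obtain ⟨α, hα, rfl⟩ := h
  exact P.hat_mem_rootSet hα.1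

lemma hatSimpleRoots_finite [Finite ι] : P.hatSimpleRoots.Finite :=
  (finite_range P.root).subset fun _ h ↦ P.mem_rootSet_of_mem_hatSimpleRoots h

/-- The simple roots are the base attached by Mathlib to the identity map of `M`, regarded as a map
to an ordered group. -/
lemma image_root_baseOf :
    P.root '' IsAddIndecomposable.baseOf P.root (AddMonoidHom.id M) = P.simpleRoots := by
  ext x
  simp only [IsAddIndecomposable.baseOf, IsAddIndecomposable, simpleRoots, rootSet, mem_image,
    mem_ofPred_eq, AddMonoidHom.id_apply, mem_range, forall_exists_index,
    forall_apply_eq_imp_iff]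
  constructor
  · rintro ⟨i, ⟨hi, h⟩, rfl⟩
    refine ⟨⟨i, rfl⟩, hi, fun j k hj hk he ↦ ?_⟩
    rcases h j hj k hk he with h0 | h0
    exacts [hj.ne' h0, hk.ne' h0]
  · rintro ⟨⟨i, rfl⟩, hi, h⟩
    exact ⟨i, ⟨hi, fun j hj k hk he ↦ (h j k hj hk he).elim⟩, rfl⟩

lemma hatSimpleRoots_pos [IsStrictOrderedModule ℝ M] {x : M} (h : x ∈ P.hatSimpleRoots) :
    0 < x := by
  obtain ⟨α, hα, rfl⟩ := h
  obtain ⟨c, hc, he⟩ := P.exists_pos_hat_eq_smul α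
  exact he ▸ smul_pos hc hα.2.1

variable [IsOrderedAddMonoid M]

lemma mem_or_neg_mem_closure_simpleRoots [Finite ι] {x : M} (hx : x ∈ P.rootSet) :
    x ∈ AddSubmonoid.closure P.simpleRoots ∨ -x ∈ AddSubmonoid.closure P.simpleRoots := by
  let _i := P.indexNeg
  obtain ⟨i, rfl⟩ := hx
  rw [← P.image_root_baseOf]
  exact IsAddIndecomposable.mem_or_neg_mem_closure_baseOf P.root (AddMonoidHom.id M) i
    (P.ne_zero i) (by simp)

lemma rootForm_simpleRoots_nonpos [Fintype ι] [P.IsCrystallographic] {α β : M}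
    (hα : α ∈ P.simpleRoots) (hβ : β ∈ P.simpleRoots) (hne : α ≠ β) : P.RootForm α β ≤ 0 := by
  rw [← P.image_root_baseOf] at hα hβ
  obtain ⟨i, hi, rfl⟩ := hα
  obtain ⟨j, hj, rfl⟩ := hβ
  have h := P.baseOf_pairwise_pairing_le_zero (AddMonoidHom.id M) (fun i ↦ P.ne_zero i) hi hj
    (fun h ↦ hne (h ▸ rfl))
  exact le_of_not_gt fun hlt ↦ h.not_gt <| by
    have h2 := (P.posRootForm ℝ).toInvariantForm.two_mul_apply_root_root i j
    have h3 : 0 < P.RootForm (P.root j) (P.root j) :=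
      P.rootForm_pos_of_ne_zero (Submodule.subset_span ⟨j, rfl⟩) (P.ne_zero j)
    simp only [RootPositiveForm.toInvariantForm_form, posRootForm] at h2
    have h4 : 0 < P.pairing i j := by
      by_contra! h5
      nlinarith [mul_nonpos_of_nonpos_of_nonneg h5 h3.le]
    rw [← P.algebraMap_pairingIn ℤ] at h4
    simpa using h4

variable [IsStrictOrderedModule ℝ M]

/-- Positive vectors of an ordered real vector space which pairwise subtend obtuse angles are
linearly independent. Positivity refers to an order on the space itself, not to a functional. -/
lemma _root_.LinearMap.BilinForm.linearIndependent_of_pos_of_pairwise_nonpos {I : Type*}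
    (B : LinearMap.BilinForm ℝ M) (hB : ∀ x, B x x ≤ 0 → x = 0) (v : I → M)
    (hp : ∀ i, 0 < v i) (hn : Pairwise fun i j ↦ B (v i) (v j) ≤ 0) :
    LinearIndependent ℝ v := by
  classical
  refine linearIndependent_iff'.mpr fun s c hc ↦ ?_
  -- Both sides of `x = y` are nonnegative combinations, with disjoint supports.
  set x := ∑ i ∈ s, (c i)⁺ • v i with hx
  set y := ∑ i ∈ s, (c i)⁻ • v i with hy
  have hxy : x = y := by
    rw [← sub_eq_zero, hx, hy, ← Finset.sum_sub_distrib, ← hc]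
    simp_rw [← sub_smul, posPart_sub_negPart]
  have hx0 : x = 0 := by
    apply hB
    nth_rw 2 [hxy]
    simp only [hx, hy, map_sum, LinearMap.sum_apply, map_smul, LinearMap.smul_apply, smul_eq_mul,
      Finset.mul_sum]
    refine Finset.sum_nonpos fun i _ ↦ Finset.sum_nonpos fun j _ ↦ ?_
    rcases eq_or_ne i j with rfl | hij
    · rcases le_total 0 (c i) with h | h
      · simp [negPart_eq_zero.2 h]
      · simp [posPart_eq_zero.2 h]
    · exact mul_nonpos_of_nonneg_of_nonpos (negPart_nonneg _)
        (mul_nonpos_of_nonneg_of_nonpos (posPart_nonneg _) (hn hij.symm))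
  have H (d : I → ℝ) (hd : ∀ i, 0 ≤ d i) (h : ∑ i ∈ s, d i • v i = 0) (i) (hi : i ∈ s) :
      d i = 0 := by
    rw [Finset.sum_eq_zero_iff_of_nonneg fun j _ ↦ smul_nonneg (hd j) (hp j).le] at h
    exact (smul_eq_zero.1 (h i hi)).resolve_right (hp i).ne'
  intro i hi
  rw [← posPart_sub_negPart (c i), H _ (fun _ ↦ posPart_nonneg _) hx0 i hi,
    H _ (fun _ ↦ negPart_nonneg _) (hxy.symm.trans hx0) i hi, sub_zero]

lemma linearIndependent_hatSimpleRoots [Fintype ι] [P.IsRootSystem] [P.IsCrystallographic] :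
    LinearIndependent ℝ ((↑) : P.hatSimpleRoots → M) := by
  refine P.RootForm.linearIndependent_of_pos_of_pairwise_nonpos
    (fun _ ↦ P.eq_zero_of_rootForm_self_nonpos) _ (fun x ↦ P.hatSimpleRoots_pos x.2) ?_
  · rintro ⟨_, α, hα, rfl⟩ ⟨_, β, hβ, rfl⟩ hne
    obtain ⟨c, hc, hcα⟩ := P.exists_pos_hat_eq_smul α
    obtain ⟨d, hd, hdβ⟩ := P.exists_pos_hat_eq_smul β
    have h := P.rootForm_simpleRoots_nonpos hα hβ fun h ↦ hne (by simp [h])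
    simp only [hcα, hdβ, map_smul, LinearMap.smul_apply, smul_eq_mul]
    exact mul_nonpos_of_nonneg_of_nonpos hd.le (mul_nonpos_of_nonneg_of_nonpos hc.le h)

/-- The set `Δ̂` is a basis of `M` in which the coordinates of each root have a common sign. -/
lemma exists_basis_hatSimpleRoots [Fintype ι] [P.IsRootSystem] [P.IsCrystallographic] :
    ∃ b : Module.Basis P.hatSimpleRoots ℝ M, (∀ i, b i = i) ∧
      ∀ x ∈ P.rootSet, (∀ i, 0 ≤ b.repr x i) ∨ ∀ i, b.repr x i ≤ 0 := by
  have hspan : ⊤ ≤ Submodule.span ℝ (range ((↑) : P.hatSimpleRoots → M)) := by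
    rw [Subtype.range_coe, ← IsRootSystem.span_root_eq_top (P := P), Submodule.span_le]
    have hle : AddSubmonoid.closure P.simpleRoots ≤
        (Submodule.span ℝ P.hatSimpleRoots).toAddSubmonoid := by
      refine AddSubmonoid.closure_le.2 fun α hα ↦ ?_
      obtain ⟨c, -, h⟩ := P.exists_pos_eq_smul_hat α
      rw [h]
      exact Submodule.smul_mem _ _ (Submodule.subset_span ⟨α, hα, rfl⟩)
    intro x hx
    rcases P.mem_or_neg_mem_closure_simpleRoots hx with h | h
    · exact hle h
    · exact neg_mem_iff.1 (hle h)
  let b := Module.Basis.mk P.linearIndependent_hatSimpleRoots hspan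
  have hb (i) : b i = i := Module.Basis.mk_apply _ _ i
  refine ⟨b, hb, fun x hx ↦ ?_⟩
  have hnn {y : M} (hy : y ∈ AddSubmonoid.closure P.simpleRoots) (i) : 0 ≤ b.repr y i := by
    induction hy using AddSubmonoid.closure_induction with
    | mem α hα =>
      obtain ⟨c, hc, h⟩ := P.exists_pos_eq_smul_hat α
      have hba : b ⟨P.hat α, α, hα, rfl⟩ = P.hat α := hb _
      rw [h, ← hba, map_smul, Module.Basis.repr_self, Finsupp.smul_apply, smul_eq_mul]
      exact mul_nonneg hc.le (by classical rw [Finsupp.single_apply]; split_ifs <;> simp)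
    | zero => simp
    | add x y _ _ hx hy => simpa using add_nonneg hx hy
  rcases P.mem_or_neg_mem_closure_simpleRoots hx with h | h
  · exact .inl (hnn h)
  · exact .inr fun i ↦ by simpa using hnn h i

end SimpleRoots

/-! ### Longest roots with prescribed signs -/

section LongestRoots

lemma reflection_mem_rootSet_iff (i : ι) (x : M) :
    P.reflection i x ∈ P.rootSet ↔ x ∈ P.rootSet := by
  have h {y : M} (hy : y ∈ P.rootSet) : P.reflection i y ∈ P.rootSet := by
    obtain ⟨j, rfl⟩ := hy
    exact ⟨P.reflectionPerm i j, P.root_reflectionPerm i j⟩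
  exact ⟨fun hx ↦ by simpa using h hx, h⟩

lemma reflection_sub_self_mem (i : ι) (x : M) (S : Submodule ℝ M) (h : P.root i ∈ S) :
    P.reflection i x - x ∈ S := by
  rw [reflection_apply, sub_sub_cancel_left]
  exact S.neg_mem (S.smul_mem _ h)

variable [Fintype ι]

lemma two_mul_rootForm_root (i : ι) (x : M) :
    2 * P.RootForm x (P.root i) = P.coroot' i x * P.RootForm (P.root i) (P.root i) := by
  have h := P.rootForm_reflection_reflection_apply i x (P.root i)
  rw [reflection_apply_self, reflection_apply] at h
  simp only [map_neg, map_sub, map_smul, LinearMap.sub_apply, LinearMap.smul_apply,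
    smul_eq_mul] at h
  linarith

/-- If the reflection in a root `β` does not increase `f` at `x`, then `(x, β)` and `f β` have
the same sign (in the weak sense). -/
lemma rootForm_mul_nonneg_of_apply_reflection_le (f : Module.Dual ℝ M) (i : ι) (x : M)
    (h : f (P.reflection i x) ≤ f x) : 0 ≤ P.RootForm x (P.root i) * f (P.root i) := by
  have h2 := P.two_mul_rootForm_root i x
  have h3 : 0 ≤ P.RootForm (P.root i) (P.root i) := P.zero_le_rootForm _
  rw [reflection_apply, map_sub, map_smul, smul_eq_mul] at h
  have h4 : 2 * (P.RootForm x (P.root i) * f (P.root i)) =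
      P.RootForm (P.root i) (P.root i) * (P.coroot' i x * f (P.root i)) := by
    rw [← mul_assoc, h2]
    ring
  linarith [mul_nonneg h3 (by linarith : 0 ≤ P.coroot' i x * f (P.root i))]

/-- A linear automorphism of `M` which behaves like an element of the Weyl group generated by
reflections in roots lying in `S`: it is an isometry, it preserves the roots and it moves vectors
only by elements of `S`. -/
structure IsRelativeWeylElement (S : Submodule ℝ M) (w : M ≃ₗ[ℝ] M) : Prop where
  isometry (x y : M) : P.RootForm (w x) (w y) = P.RootForm x y
  mem_rootSet_iff (x : M) : w x ∈ P.rootSet ↔ x ∈ P.rootSet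
  sub_self_mem (x : M) : w x - x ∈ S

variable {P} in
lemma IsRelativeWeylElement.reflection_mul {S : Submodule ℝ M} {w : M ≃ₗ[ℝ] M}
    (hw : P.IsRelativeWeylElement S w) {i : ι} (hi : P.root i ∈ S) :
    P.IsRelativeWeylElement S (w.trans (P.reflection i)) where
  isometry x y := by
    simp only [LinearEquiv.trans_apply, rootForm_reflection_reflection_apply, hw.isometry]
  mem_rootSet_iff x := by
    rw [LinearEquiv.trans_apply, reflection_mem_rootSet_iff, hw.mem_rootSet_iff]
  sub_self_mem x := by
    rw [LinearEquiv.trans_apply, ← sub_add_sub_cancel _ (w x)]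
    exact S.add_mem (P.reflection_sub_self_mem i _ S hi) (hw.sub_self_mem x)

/-- A root made extremal for a functional `f` pairs with each root `β` of `S` with the sign of
`f β` (in the weak sense). -/
lemma exists_isRelativeWeylElement_apply_max (S : Submodule ℝ M) (f : Module.Dual ℝ M) {θ : M}
    (hθ : θ ∈ P.rootSet) : ∃ w, P.IsRelativeWeylElement S w ∧
      ∀ i, P.root i ∈ S → 0 ≤ P.RootForm (w θ) (P.root i) * f (P.root i) := by
  have hfin : {x | ∃ w, P.IsRelativeWeylElement S w ∧ w θ = x}.Finite := by
    refine (finite_range P.root).subset ?_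
    rintro _ ⟨w, hw, rfl⟩
    exact (hw.mem_rootSet_iff θ).2 hθ
  obtain ⟨_, ⟨w, hw, rfl⟩, hmax⟩ := exists_max_image _ f hfin
    ⟨θ, LinearEquiv.refl ℝ M, ⟨fun _ _ ↦ rfl, fun _ ↦ Iff.rfl, by simp⟩, rfl⟩
  exact ⟨w, hw, fun i hi ↦ P.rootForm_mul_nonneg_of_apply_reflection_le f i _
    (hmax _ ⟨_, hw.reflection_mul hi, rfl⟩)⟩

/-- The span of a nonempty set `J` of basis vectors contains a root of maximal length that is
dominant for `J`. -/
lemma exists_longest_dominant {I : Type*} (b : Module.Basis I ℝ M)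
    (hb : ∀ i, b i ∈ P.rootSet) {J : Set I} (hJ : J.Nonempty) :
    ∃ θ ∈ P.rootSet, θ ∈ Submodule.span ℝ (b '' J) ∧
      (∀ φ ∈ P.rootSet, φ ∈ Submodule.span ℝ (b '' J) → P.RootForm φ φ ≤ P.RootForm θ θ) ∧
      ∀ i ∈ J, 0 ≤ P.RootForm θ (b i) := by
  set S := Submodule.span ℝ (b '' J)
  obtain ⟨j, hj⟩ := hJ
  have hfin : (P.rootSet ∩ S).Finite := (finite_range P.root).subset inter_subset_left
  obtain ⟨η, hη, hlong⟩ := exists_max_image _ (fun x ↦ P.RootForm x x) hfin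
    ⟨b j, hb j, Submodule.subset_span ⟨j, hj, rfl⟩⟩
  -- Any functional that is positive on the basis serves as height.
  obtain ⟨w, hw, h⟩ := P.exists_isRelativeWeylElement_apply_max S (b.constr ℝ fun _ ↦ (1 : ℝ)) hη.1
  refine ⟨w η, (hw.mem_rootSet_iff η).2 hη.1, ?_, ?_, fun i hi ↦ ?_⟩
  · simpa using S.add_mem (hw.sub_self_mem η) hη.2
  · intro φ hφ hφS
    rw [hw.isometry]
    exact hlong φ ⟨hφ, hφS⟩
  · obtain ⟨k, hk⟩ := hb i
    simpa [hk, Module.Basis.constr_basis] using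
      h k (hk ▸ Submodule.subset_span ⟨i, hi, rfl⟩)

/-- The key step: `a` is any member of `J` not orthogonal to the dominant longest root `θ`. The
root `σ = w θ` is made extremal for the signs prescribed on `J \ {a}` by some `w` that moves vectors
only along `J \ {a}`. Then `(σ, a) = (θ, w⁻¹ a)`, and the root `w⁻¹ a` has the same coordinate `1`
along `a` as `a` itself, so all its coordinates are nonnegative and `(θ, w⁻¹ a) ≥ (θ, a) > 0`. -/
lemma exists_longest_with_signs [P.IsRootSystem] {I : Type*} (b : Module.Basis I ℝ M)
    (hb : ∀ i, b i ∈ P.rootSet)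
    (hsign : ∀ x ∈ P.rootSet, (∀ i, 0 ≤ b.repr x i) ∨ ∀ i, b.repr x i ≤ 0)
    {J : Set I} (hJ : J.Nonempty) :
    ∃ a ∈ J, ∀ D : Set I, ∃ σ ∈ P.rootSet, σ ∈ Submodule.span ℝ (b '' J) ∧
      (∀ φ ∈ P.rootSet, φ ∈ Submodule.span ℝ (b '' J) → P.RootForm φ φ ≤ P.RootForm σ σ) ∧
      0 < P.RootForm σ (b a) ∧ ∀ i ∈ J, i ≠ a →
        (i ∈ D → 0 ≤ P.RootForm σ (b i)) ∧ (i ∉ D → P.RootForm σ (b i) ≤ 0) := by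
  classical
  obtain ⟨θ, hθ, hθS, hlong, hdom⟩ := P.exists_longest_dominant b hb hJ
  obtain ⟨a, haJ, ha⟩ : ∃ a ∈ J, 0 < P.RootForm θ (b a) := by
    by_contra! h
    have hz : Submodule.span ℝ (b '' J) ≤ LinearMap.ker (P.RootForm θ) := by
      rw [Submodule.span_le]
      rintro _ ⟨i, hi, rfl⟩
      exact (h i hi).antisymm (hdom i hi)
    have hθ0 : θ = 0 := P.eq_zero_of_rootForm_self_nonpos (hz hθS).le
    obtain ⟨k, hk⟩ := hθ
    exact P.ne_zero k (hk.trans hθ0)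
  refine ⟨a, haJ, fun D ↦ ?_⟩
  set S := Submodule.span ℝ (b '' (J \ {a}))
  have hSJ : S ≤ Submodule.span ℝ (b '' J) := Submodule.span_mono (image_mono sdiff_subset)
  let f : Module.Dual ℝ M := b.constr ℝ fun i ↦ if i ∈ D then (1 : ℝ) else -1
  obtain ⟨w, hw, hmax⟩ := P.exists_isRelativeWeylElement_apply_max S f hθ
  refine ⟨w θ, (hw.mem_rootSet_iff θ).2 hθ, ?_, ?_, ?_, fun i hi hia ↦ ?_⟩
  · simpa using add_mem (hSJ (hw.sub_self_mem θ)) hθS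
  · intro φ hφ hφS
    rw [hw.isometry]
    exact hlong φ hφ hφS
  · set x := w.symm (b a) with hx
    have hxw : w x = b a := w.apply_symm_apply _
    have hxΦ : x ∈ P.rootSet := (hw.mem_rootSet_iff x).1 (hxw ▸ hb a)
    have hmem : x - b a ∈ S := by
      rw [← hxw, ← neg_sub]
      exact S.neg_mem (hw.sub_self_mem x)
    have hsupp := b.mem_span_image.1 hmem
    have hcoord (i) (hi : i ∉ J \ {a}) : b.repr x i = b.repr (b a) i := by
      have h0 : b.repr (x - b a) i = 0 := Finsupp.notMem_support_iff.1 fun h ↦ hi (hsupp h)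
      rwa [map_sub, Finsupp.sub_apply, sub_eq_zero] at h0
    have hxa : b.repr x a = 1 := by rw [hcoord a (by simp)]; simp
    have hnn : ∀ i, 0 ≤ b.repr x i := by
      rcases hsign x hxΦ with h | h
      · exact h
      · linarith [h a]
    rw [← hxw, hw.isometry, ← b.linearCombination_repr x, Finsupp.linearCombination_apply,
      Finsupp.sum, map_sum]
    have hterm (i) (hi : i ∈ (b.repr x).support) :
        0 ≤ P.RootForm θ (b.repr x i • b i) := by
      rw [map_smul, smul_eq_mul]
      refine mul_nonneg (hnn i) (hdom i ?_)
      by_contra hiJ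
      have hia : a ≠ i := fun h ↦ hiJ (h ▸ haJ)
      have := hcoord i (fun h ↦ hiJ h.1)
      simp [hia] at this
      exact Finsupp.mem_support_iff.1 hi this
    refine Finset.sum_pos' hterm ⟨a, Finsupp.mem_support_iff.2 (by simp [hxa]), ?_⟩
    simpa [hxa] using ha
  · obtain ⟨k, hk⟩ := hb i
    have h := hmax k (hk ▸ Submodule.subset_span ⟨i, ⟨hi, hia⟩, rfl⟩)
    simp only [hk, f, Module.Basis.constr_basis] at h
    constructor
    · intro hD
      simpa [hD] using h
    · intro hD
      simpa [hD] using h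

/-- A vector that forms a nonobtuse angle with `c • b` gets longer when `c • b` is added, so the
result cannot be a root or zero if the vector was at least as long as every root of the subspace. -/
lemma longest_add_smul_notMem_rootSetZero [P.IsRootSystem] {S : Submodule ℝ M} {σ b : M} {c : ℝ}
    (hσ : σ ∈ S) (hlong : ∀ φ ∈ P.rootSet, φ ∈ S → P.RootForm φ φ ≤ P.RootForm σ σ)
    (hb : b ∈ S) (hb0 : b ≠ 0) (hc : c ≠ 0) (h : 0 ≤ c * P.RootForm σ b) :
    σ + c • b ∉ P.rootSetZero := by
  have hbb : 0 < P.RootForm b b := (P.zero_le_rootForm b).lt_of_ne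
    fun h ↦ hb0 (P.eq_zero_of_rootForm_self_nonpos h.ge)
  have hsymm : P.RootForm b σ = P.RootForm σ b := P.rootForm_symmetric.eq b σ
  have hlt : P.RootForm σ σ < P.RootForm (σ + c • b) (σ + c • b) := by
    simp only [map_add, map_smul, LinearMap.add_apply, LinearMap.smul_apply, smul_eq_mul, hsymm]
    nlinarith [mul_pos (mul_self_pos.2 hc) hbb]
  rintro (h | h)
  · exact hlt.not_ge (hlong _ h (S.add_mem hσ (S.smul_mem c hb)))
  · rw [mem_singleton_iff.1 h, map_zero] at hlt
    exact hlt.not_ge (P.zero_le_rootForm σ)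

end LongestRoots

lemma neg_mem_rootSetZero {x : M} (h : x ∈ P.rootSetZero) : -x ∈ P.rootSetZero := by
  rcases h with ⟨i, rfl⟩ | h
  · exact .inl (by simp [rootSet])
  · exact .inr (by simpa using h)

lemma sub_mem_rootSetZero_of_rootForm_pos [Fintype ι] [P.IsCrystallographic] {x y : M}
    (hx : x ∈ P.rootSet) (hy : y ∈ P.rootSet) (h : 0 < P.RootForm x y) :
    x - y ∈ P.rootSetZero := by
  obtain ⟨i, rfl⟩ := hx
  obtain ⟨j, rfl⟩ := hy
  rcases eq_or_ne i j with rfl | hij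
  · exact .inr (by simp)
  · refine .inl (P.root_sub_root_mem_of_pairingIn_pos ?_ hij)
    have h2 := P.two_mul_rootForm_root j (P.root i)
    rw [root_coroot'_eq_pairing] at h2
    have h3 : 0 < P.pairing i j :=
      pos_of_mul_pos_left (h2 ▸ by linarith) (P.zero_le_rootForm (P.root j))
    rw [← P.algebraMap_pairingIn ℤ] at h3
    simpa using h3

end RootPairing

/-! ### Orderings by successive choice of last elements -/

/-- If every nonempty subset of a finite type has an admissible last element, then there is a
total ordering in which each element is admissible as the last element of its initial segment. -/
lemma exists_isStrictTotalOrder_of_exists_last {I : Type*} [Finite I] (Q : Set I → I → Prop)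
    (hQ : ∀ J : Set I, J.Nonempty → ∃ a ∈ J, Q J a) :
    ∃ r : I → I → Prop, IsStrictTotalOrder I r ∧ ∀ a, Q {i | r i a ∨ i = a} a := by
  classical
  have key (s : Finset I) : ∃ g : I → ℕ, InjOn g s ∧ ∀ a ∈ s, Q {i | i ∈ s ∧ g i ≤ g a} a := by
    induction s using Finset.strongInduction with
    | H s ih =>
      rcases s.eq_empty_or_nonempty with rfl | hs
      · exact ⟨fun _ ↦ 0, by simp, by simp⟩
      obtain ⟨a, ha, hQa⟩ := hQ s hs
      obtain ⟨g, hg, hgQ⟩ := ih (s.erase a) (Finset.erase_ssubset ha)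
      have hlt (i) (hi : i ∈ s) : g i < s.sup g + 1 := Nat.lt_succ_of_le (Finset.le_sup hi)
      refine ⟨Function.update g a (s.sup g + 1), ?_, fun i hi ↦ ?_⟩
      · intro i hi j hj h
        have hi' := hlt i hi
        have hj' := hlt j hj
        by_cases hia : i = a <;> by_cases hja : j = a
        · rw [hia, hja]
        · simp [hia, hja] at h; omega
        · simp [hia, hja] at h; omega
        · simp only [Function.update_of_ne hia, Function.update_of_ne hja] at h
          exact hg (by simpa [hia] using hi) (by simpa [hja] using hj) h
      · by_cases hia : i = a
        · subst hia
          convert hQa using 1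
          ext j
          simp only [mem_ofPred_eq, Function.update_self, Finset.mem_coe, and_iff_left_iff_imp]
          intro hj
          rcases eq_or_ne j i with rfl | hji
          · simp
          · simpa [hji] using (hlt j hj).le
        · convert hgQ i (Finset.mem_erase.2 ⟨hia, hi⟩) using 1
          ext j
          rcases eq_or_ne j a with rfl | hja
          · have := hlt i hi
            simp [hia]
            omega
          · simp [hia, hja]
  have := Fintype.ofFinite I
  obtain ⟨g, hg, hgQ⟩ := key Finset.univ
  have hinj (i j : I) (h : g i = g j) : i = j := hg (by simp) (by simp) h
  refine ⟨fun i j ↦ g i < g j, { trichotomous := ?_, irrefl := ?_, trans := ?_ }, fun a ↦ ?_⟩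
  · intro i j h1 h2
    exact hinj i j (by omega)
  · exact fun i ↦ lt_irrefl _
  · exact fun i j k ↦ lt_trans
  · convert hgQ a (Finset.mem_univ a) using 1
    ext i
    simp only [mem_ofPred_eq, Finset.mem_univ, true_and, le_iff_lt_or_eq]
    exact or_congr_right ⟨fun h ↦ h ▸ rfl, hinj i a⟩

/-! ### Roots adapted to a labeling -/

theorem mainTheorem10 {ι M N : Type*} [Finite ι] [AddCommGroup M] [Module ℝ M]
    [AddCommGroup N] [Module ℝ N] (P : RootPairing ι ℝ M N) [P.IsRootSystem]
    [P.IsCrystallographic]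
    [LinearOrder M] [IsOrderedAddMonoid M] [IsStrictOrderedModule ℝ M] :
    ∃ r : P.hatSimpleRoots → P.hatSimpleRoots → Prop, IsStrictTotalOrder P.hatSimpleRoots r ∧
      ∀ (a : P.hatSimpleRoots) (label : {b : P.hatSimpleRoots // r b a} → NodeLabel),
        ∃ σ ∈ P.rootSetZero, ∃ μ ∈ P.rootSetZero,
          μ - σ = (a : M) ∧
          (∀ φ ∈ P.rootSetZero, ∀ b : P.hatSimpleRoots, IsDNode label b →
            ¬ IsPosMultiple (σ - φ) (b : M)) ∧
          (∀ φ ∈ P.rootSetZero, ∀ b : P.hatSimpleRoots, IsUNode label b →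
            ¬ IsPosMultiple (φ - σ) (b : M)) := by
  have := Fintype.ofFinite ι
  have : Finite P.hatSimpleRoots := P.hatSimpleRoots_finite
  obtain ⟨b, hb, hsign⟩ := P.exists_basis_hatSimpleRoots
  have hbΦ (i) : b i ∈ P.rootSet := by
    rw [hb]
    exact P.mem_rootSet_of_mem_hatSimpleRoots i.2
  obtain ⟨r, hr, hQ⟩ := exists_isStrictTotalOrder_of_exists_last _
    fun (J : Set P.hatSimpleRoots) hJ ↦ P.exists_longest_with_signs b hbΦ hsign hJ
  have hirr (a) : ¬ r a a := hr.toIsStrictOrder.irrefl a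
  refine ⟨r, hr, fun a label ↦ ?_⟩
  obtain ⟨σ, hσ, hσS, hlong, hσa, hsgn⟩ := hQ a {i | IsDNode label i}
  set J : Set P.hatSimpleRoots := {i | r i a ∨ i = a}
  have hspan (i) (hi : i ∈ J) : (i : M) ∈ Submodule.span ℝ (b '' J) :=
    Submodule.subset_span ⟨i, hi, hb i⟩
  have hne (i : P.hatSimpleRoots) : (i : M) ≠ 0 := hb i ▸ b.ne_zero i
  simp only [hb] at hσa hsgn
  -- The root `σ` has `(σ, a) > 0`, so it is its negative that admits the addition of `a`.
  refine ⟨-σ, P.neg_mem_rootSetZero (.inl hσ), -(σ - a), P.neg_mem_rootSetZero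
    (P.sub_mem_rootSetZero_of_rootForm_pos hσ (hb a ▸ hbΦ a) hσa), by abel, ?_, ?_⟩
  · rintro φ hφ i hi ⟨c, hc, h⟩
    have hiJ : i ∈ J := hi.elim .inr fun ⟨h, _⟩ ↦ .inl h
    have hnn : 0 ≤ P.RootForm σ i := by
      rcases eq_or_ne i a with rfl | hia
      · exact hσa.le
      · exact (hsgn i hiJ hia).1 hi
    refine P.longest_add_smul_notMem_rootSetZero hσS hlong (hspan i hiJ) (hne i) hc.ne'
      (mul_nonneg hc.le hnn) ?_
    rw [← h, show σ + (-σ - φ) = -φ by abel]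
    exact P.neg_mem_rootSetZero hφ
  · rintro φ hφ i ⟨hi, hU⟩ ⟨c, hc, h⟩
    have hia : i ≠ a := by
      rintro rfl
      exact hirr _ hi
    have hnD : ¬ IsDNode label i := by
      rintro (h | ⟨_, hD⟩)
      · exact hia h
      · simp [hU] at hD
    refine P.longest_add_smul_notMem_rootSetZero (c := -c) hσS hlong (hspan i (.inl hi)) (hne i)
      (neg_ne_zero.2 hc.ne')
      (mul_nonneg_of_nonpos_of_nonpos (neg_nonpos.2 hc.le) ((hsgn i (.inl hi) hia).2 hnD)) ?_
    rw [neg_smul, ← h]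
    simpa using P.neg_mem_rootSetZero hφ
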